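/- Let $\mathbb{G}$ be a measurable space of goals, let $\mathcal{G}$ (goal generators) and $\Pi$ (policies) be nonempty compact metric spaces, let every generator $G\in\mathcal{G}$ have a probability distribution on $\mathbb{G}$, also written $G$, and let $R(g,\pi)\in\mathbb{R}$ be the return of the policy $\pi\in\Pi$ on the goal $g\in\mathbb{G}$ (here an arbitrary real function on $\mathbb{G}\times\Pi$). For $g_A,g_B\in\mathbb{G}$ and $\pi_A,\pi_B\in\Pi$ put $$f(g_A,g_B,\pi_A,\pi_B)=\bigl(R(g_A,\pi_A)-R(g_A,\pi_B)\bigr)-\bigl(R(g_B,\pi_B)-R(g_B,\pi_A)\bigr),$$ and assume that, for all $G_A,G_B\in\mathcal{G}$ and $\pi_A,\pi_B\in\Pi$, the expectation $$F(G_A,G_B,\pi_A,\pi_B)=\mathbb{E}_{g_A\sim G_A,\;g_B\sim G_B}\bigl[f(g_A,g_B,\pi_A,\pi_B)\bigr]$$ over independent goals $g_A,g_B$ exists (that is, $f(\cdot,\cdot,\pi_A,\pi_B)$ is integrable). The CuSP game is the two-player zero-sum game in which both players (the generator-solver teams) have the set of pure strategies $\mathcal{G}\times\Pi$ and in which, when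 the first team plays $(G_A,\pi_A)$ and the second plays $(G_B,\pi_B)$, the first team receives the payoff $F(G_A,G_B,\pi_A,\pi_B)$ and the second receives $-F(G_A,G_B,\pi_A,\pi_B)$. A mixed strategy is a Borel probability measure on $\mathcal{G}\times\Pi$. **Proposition.** If $F$ is continuous on $\mathcal{G}\times\mathcal{G}\times\Pi\times\Pi$, then the CuSP game has a mixed-strategy Nash equilibrium: there are Borel probability measures $\sigma^*,\tau^*$ on $\mathcal{G}\times\Pi$ such that, with $$U(\sigma,\tau)=\iint F(G_A,G_B,\pi_A,\pi_B)\,d\sigma(G_A,\pi_A)\,d\tau(G_B,\pi_B),$$ one has $U(\sigma,\tau^*)\le U(\sigma^*,\tau^*)\le U(\sigma^*,\tau)$ for all Borel probability measures $\sigma,\tau$ on $\mathcal{G}\times\Pi$; in particular all these integrals exist. -/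

import Mathlib

open MeasureTheory

noncomputable section

/-- A two-player game in normal form: `X` and `Y` are the sets of pure strategies of the first and
of the second player, and both players maximize their own payoff. -/
structure TwoPlayerGame (X Y : Type*) where
  payoff₁ : X × Y → ℝ
  payoff₂ : X × Y → ℝ

namespace TwoPlayerGame

/-- A pair `(σ, τ)` of mixed strategies (probability measures on the pure strategies, drawn
independently by the two players) is a Nash equilibrium if no player can raise the expectation of
their own payoff by changing to another mixed strategy, the opponent's being kept fixed. All the
expected payoffs that are compared are required to exist. -/
structure IsMixedNash {X Y : Type*} [MeasurableSpace X] [MeasurableSpace Y]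
    (Γ : TwoPlayerGame X Y) (σ : ProbabilityMeasure X) (τ : ProbabilityMeasure Y) : Prop where
  integrable₁ : ∀ σ' : ProbabilityMeasure X,
    Integrable Γ.payoff₁ ((σ' : Measure X).prod (τ : Measure Y))
  integrable₂ : ∀ τ' : ProbabilityMeasure Y,
    Integrable Γ.payoff₂ ((σ : Measure X).prod (τ' : Measure Y))
  best₁ : ∀ σ' : ProbabilityMeasure X,
    ∫ p, Γ.payoff₁ p ∂((σ' : Measure X).prod (τ : Measure Y)) ≤
      ∫ p, Γ.payoff₁ p ∂((σ : Measure X).prod (τ : Measure Y))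
  best₂ : ∀ τ' : ProbabilityMeasure Y,
    ∫ p, Γ.payoff₂ p ∂((σ : Measure X).prod (τ' : Measure Y)) ≤
      ∫ p, Γ.payoff₂ p ∂((σ : Measure X).prod (τ : Measure Y))

end TwoPlayerGame

namespace CuSP

/-- The regret on the goal `g` of the policy `π` relative to the policy `π'`, where `R g π` is the
discounted return of `π` on the goal `g`. -/
def regret {Goal Pol : Type*} (R : Goal → Pol → ℝ) (g : Goal) (π π' : Pol) : ℝ :=
  R g π - R g π'

/-- The sampled objective: Alice's regret on `gA` minus Bob's regret on `gB`. -/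
def sampleObjective {Goal Pol : Type*} (R : Goal → Pol → ℝ) (gA gB : Goal) (πA πB : Pol) : ℝ :=
  regret R gA πA πB - regret R gB πB πA

/-- The payoff `F(G_A, G_B, π_A, π_B)`: the expectation of the sampled objective over independent
goals `gA ∼ G_A` and `gB ∼ G_B`; `law G` is the distribution of the goals proposed by the
generator `G`. -/
def payoff {Goal Gen Pol : Type*} [MeasurableSpace Goal] (law : Gen → ProbabilityMeasure Goal)
    (R : Goal → Pol → ℝ) (GA GB : Gen) (πA πB : Pol) : ℝ :=
  ∫ g : Goal × Goal, sampleObjective R g.1 g.2 πA πB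
    ∂((law GA : Measure Goal).prod (law GB : Measure Goal))

/-- The zero-sum game between the teams `(G_A, π_A)` and `(G_B, π_B)`: a pure strategy of a team
is a pair of a goal generator and a policy, the first team receives `F` and the second `-F`. -/
def game {Goal Gen Pol : Type*} [MeasurableSpace Goal] (law : Gen → ProbabilityMeasure Goal)
    (R : Goal → Pol → ℝ) : TwoPlayerGame (Gen × Pol) (Gen × Pol) where
  payoff₁ p := payoff law R p.1.1 p.2.1 p.1.2 p.2.2
  payoff₂ p := -payoff law R p.1.1 p.2.1 p.1.2 p.2.2

end CuSP

end

/-! Exchanging the teams negates the payoff, so the value can only be zero, and a mixed strategy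
that secures at least zero against every pure strategy is in equilibrium with itself. Such a
strategy comes from duality: a convex combination of the functions `x ↦ A (x, y)` is never negative
everywhere, since averaging it with its own weights gives zero by antisymmetry. Hahn-Banach
separates the hull of these functions from the open cone of negative ones, and Riesz makes the
separating functional a probability measure. -/

/-- A nonzero positive linear functional on `C(X, ℝ)`, for a compact space `X`, is a positive
multiple of the integration against a probability measure. -/
theorem exists_probabilityMeasure_of_positive {X : Type*} [TopologicalSpace X] [CompactSpace X]
    [T2Space X] [MeasurableSpace X] [BorelSpace X] (L : C(X, ℝ) →ₗ[ℝ] ℝ)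
    (hL : ∀ g : C(X, ℝ), 0 ≤ g → 0 ≤ L g) (h1 : 0 < L 1) :
    ∃ σ : ProbabilityMeasure X, ∀ g : C(X, ℝ), L g = L 1 * ∫ x, g x ∂(σ : Measure X) := by
  let Λ : CompactlySupportedContinuousMap X ℝ →ₚ[ℝ] ℝ := PositiveLinearMap.mk₀
    { toFun := fun g => L g.toContinuousMap
      map_add' := fun f g => L.map_add f.toContinuousMap g.toContinuousMap
      map_smul' := fun c g => L.map_smul c g.toContinuousMap }
    fun g hg => hL g.toContinuousMap hg
  have hΛ (g : C(X, ℝ)) : ∫ x, g x ∂(RealRMK.rieszMeasure Λ) = L g :=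
    RealRMK.integral_rieszMeasure Λ (CompactlySupportedContinuousMap.continuousMapEquiv g)
  set μ := RealRMK.rieszMeasure Λ
  have hμ : μ.real Set.univ = L 1 := by simpa using hΛ 1
  have hne : NeZero μ := ⟨fun h => by simp [h] at hμ; exact h1.ne hμ⟩
  refine ⟨⟨(μ Set.univ)⁻¹ • μ, inferInstance⟩, fun g => ?_⟩
  have hinv : ((μ Set.univ)⁻¹).toReal = (L 1)⁻¹ := by rw [ENNReal.toReal_inv, ← hμ]; rfl
  rw [ProbabilityMeasure.coe_mk, integral_smul_measure, hΛ, hinv, smul_eq_mul,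
    mul_inv_cancel_left₀ h1.ne']

/-- **Theorem of the alternative** for convex sets of continuous functions on a compact space. -/
theorem exists_probabilityMeasure_integral_nonneg {X : Type*} [TopologicalSpace X] [CompactSpace X]
    [T2Space X] [MeasurableSpace X] [BorelSpace X] {K : Set C(X, ℝ)} (hK : Convex ℝ K)
    (hne : K.Nonempty) (h : ∀ g ∈ K, ∃ x, 0 ≤ g x) :
    ∃ σ : ProbabilityMeasure X, ∀ g ∈ K, 0 ≤ ∫ x, g x ∂(σ : Measure X) := by
  have hconv : Convex ℝ {g : C(X, ℝ) | ∀ x, g x < 0} := fun f hf g hg a b ha hb hab x =>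
    convex_Iio (0 : ℝ) (hf x) (hg x) ha hb hab
  have hopen : IsOpen {g : C(X, ℝ) | ∀ x, g x < 0} := by
    simpa [Set.MapsTo] using
      ContinuousMap.isOpen_setOfPred_mapsTo (isCompact_univ (X := X)) (isOpen_Iio (a := (0 : ℝ)))
  obtain ⟨L, u, hneg, hpos⟩ := geometric_hahn_banach_open hconv hopen hK <|
    Set.disjoint_left.2 fun g hg hgK => by
      obtain ⟨x, hx⟩ := h g hgK
      exact (hg x).not_ge hx
  -- The strict `0 < s` puts `-(t • g) - s • 1` in the open cone; the choices of `t` and `s` below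
  -- give all the sign information.
  have hscale (g : C(X, ℝ)) (hg : 0 ≤ g) (t s : ℝ) (ht : 0 ≤ t) (hs : 0 < s) :
      -(t * L g) - s * L 1 < u := by
    have := hneg (-(t • g) - s • 1) fun x => by
      have : 0 ≤ t * g x := mul_nonneg ht (hg x)
      simp only [ContinuousMap.sub_apply, ContinuousMap.neg_apply, ContinuousMap.smul_apply,
        ContinuousMap.one_apply, smul_eq_mul]
      linarith
    simpa using this
  have hL (g : C(X, ℝ)) (hg : 0 ≤ g) : 0 ≤ L g := by
    by_contra! hlt
    -- This `t` makes `-(t * L g)` equal to `|u| + |L 1|`, too large for the bound `u`.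
    have := hscale g hg ((|u| + |L 1|) / -L g) 1 (by have := neg_pos.2 hlt; positivity) one_pos
    rw [div_mul_eq_mul_div, mul_div_assoc, div_neg, div_self hlt.ne] at this
    linarith [le_abs_self u, le_abs_self (L 1)]
  have hu : 0 ≤ u := by
    by_contra! hlt
    have h1 := hL 1 (fun _ => zero_le_one)
    -- The `+ 1` keeps the denominator positive, as `L 1` may still be zero here.
    have := hscale 0 le_rfl 0 (-u / (L 1 + 1)) le_rfl (by have := neg_pos.2 hlt; positivity)
    have h2 : -u / (L 1 + 1) * L 1 ≤ -u := by
      rw [div_mul_eq_mul_div, div_le_iff₀ (by linarith)]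
      nlinarith
    simp only [zero_mul, neg_zero, zero_sub] at this
    linarith
  have h1 : 0 < L 1 := by
    refine (hL 1 fun _ => zero_le_one).lt_of_ne' fun h0 => ?_
    obtain ⟨b, hb⟩ := hne
    -- If `L 1 = 0`, positivity at `‖b‖ • 1 - b` gives `L b ≤ 0`, against `0 < u ≤ L b`.
    have hb' := hL (‖b‖ • 1 - b) fun x => by
      simpa using (le_abs_self (b x)).trans (b.norm_coe_le_norm x)
    have := hscale 0 le_rfl 0 1 le_rfl one_pos
    simp only [map_sub, map_smul, h0, smul_zero] at hb'
    simp only [h0, zero_mul, neg_zero, mul_zero, sub_zero] at this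
    linarith [hpos b hb]
  obtain ⟨σ, hσ⟩ := exists_probabilityMeasure_of_positive (L : C(X, ℝ) →ₗ[ℝ] ℝ) hL h1
  refine ⟨σ, fun g hg => nonneg_of_mul_nonneg_right ?_ h1⟩
  exact (hσ g) ▸ hu.trans (hpos g hg)

/-- A continuous antisymmetric kernel on a compact space has a mixed strategy which guarantees a
nonnegative expected payoff against every pure strategy. -/
theorem exists_probabilityMeasure_forall_integral_nonneg_of_antisymm {X : Type*}
    [TopologicalSpace X] [CompactSpace X] [T2Space X] [Nonempty X] [MeasurableSpace X]
    [BorelSpace X] (A : C(X × X, ℝ)) (hA : ∀ x y, A (y, x) = -A (x, y)) :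
    ∃ σ : ProbabilityMeasure X, ∀ y, 0 ≤ ∫ x, A (x, y) ∂(σ : Measure X) := by
  let col (y : X) : C(X, ℝ) := ⟨fun x => A (x, y), by fun_prop⟩
  obtain ⟨σ, hσ⟩ := exists_probabilityMeasure_integral_nonneg
    (convex_convexHull ℝ (Set.range col)) (Set.range_nonempty col).convexHull fun g hg => by
      obtain ⟨ι, _, w, z, hw, hw1, hz, rfl⟩ := mem_convexHull_iff_exists_fintype.1 hg
      choose y hy using hz
      by_contra! hlt
      have heval (i : ι) : (∑ j, w j • z j) (y i) = ∑ j, w j * A (y i, y j) := by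
        simp [← hy, col]
      -- The quadratic form of an antisymmetric matrix vanishes.
      have hzero : ∑ i, w i * (∑ j, w j • z j) (y i) = 0 := by
        have hneg : ∑ i, ∑ j, w i * (w j * A (y i, y j)) =
            -∑ i, ∑ j, w i * (w j * A (y i, y j)) := by
          conv_lhs => rw [Finset.sum_comm]
          simp only [← Finset.sum_neg_distrib]
          refine Finset.sum_congr rfl fun i _ => Finset.sum_congr rfl fun j _ => ?_
          rw [hA (y i) (y j)]
          ring
        simp only [heval, Finset.mul_sum]
        linarith
      obtain ⟨i, -, hi⟩ : ∃ i ∈ Finset.univ, 0 < w i :=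
        Finset.exists_lt_of_sum_lt (by simp [hw1])
      exact (Finset.sum_neg' (fun i _ => mul_nonpos_of_nonneg_of_nonpos (hw i) (hlt (y i)).le)
        ⟨i, Finset.mem_univ i, mul_neg_of_pos_of_neg hi (hlt (y i))⟩).ne hzero
  exact ⟨σ, fun y => hσ (col y) (subset_convexHull ℝ _ ⟨y, rfl⟩)⟩

namespace TwoPlayerGame

/-- A symmetric zero-sum game with a continuous payoff on a compact space of pure strategies has a
symmetric mixed Nash equilibrium. -/
theorem exists_isMixedNash_of_antisymm {X : Type*} [TopologicalSpace X] [CompactSpace X]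
    [T2Space X] [SecondCountableTopology X] [Nonempty X] [MeasurableSpace X] [BorelSpace X]
    (Γ : TwoPlayerGame X X) (hcont : Continuous Γ.payoff₁)
    (hzero : ∀ p, Γ.payoff₂ p = -Γ.payoff₁ p) (hanti : ∀ p, Γ.payoff₁ p.swap = -Γ.payoff₁ p) :
    ∃ σ : ProbabilityMeasure X, Γ.IsMixedNash σ σ := by
  obtain ⟨σ, hσ⟩ := exists_probabilityMeasure_forall_integral_nonneg_of_antisymm
    ⟨Γ.payoff₁, hcont⟩ fun x y => hanti (x, y)
  have hint (μ ν : ProbabilityMeasure X) :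
      Integrable Γ.payoff₁ ((μ : Measure X).prod (ν : Measure X)) :=
    hcont.integrable_of_hasCompactSupport (HasCompactSupport.of_compactSpace _)
  have hswap (μ ν : ProbabilityMeasure X) :
      ∫ p, Γ.payoff₁ p ∂((μ : Measure X).prod (ν : Measure X)) =
        -∫ p, Γ.payoff₁ p ∂((ν : Measure X).prod (μ : Measure X)) := by
    rw [← integral_prod_swap, ← integral_neg]
    simp only [hanti]
  have hnonneg (τ : ProbabilityMeasure X) :
      0 ≤ ∫ p, Γ.payoff₁ p ∂((σ : Measure X).prod (τ : Measure X)) := by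
    rw [integral_prod_symm _ (hint σ τ)]
    exact integral_nonneg hσ
  -- The payoff of `σ` against itself equals its own negative, hence is zero.
  have hval := hswap σ σ
  have h₂ : Γ.payoff₂ = fun p => -Γ.payoff₁ p := funext hzero
  refine ⟨σ, fun τ => hint τ σ, fun τ => h₂ ▸ (hint σ τ).neg, fun τ => ?_, fun τ => ?_⟩
  · linarith [hswap τ σ, hnonneg τ]
  · simp only [h₂, integral_neg]
    linarith [hnonneg τ]

end TwoPlayerGame

/-- Exchanging the two teams reverses the sign of the payoff. -/
theorem CuSP.payoff_swap {Goal Gen Pol : Type*} [MeasurableSpace Goal]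
    (law : Gen → ProbabilityMeasure Goal) (R : Goal → Pol → ℝ) (GA GB : Gen) (πA πB : Pol) :
    CuSP.payoff law R GB GA πB πA = -CuSP.payoff law R GA GB πA πB := by
  unfold CuSP.payoff
  rw [← integral_prod_swap, ← integral_neg]
  simp [CuSP.sampleObjective]

theorem mainTheorem2 {Goal Gen Pol : Type*} [MeasurableSpace Goal]
    [MetricSpace Gen] [CompactSpace Gen] [Nonempty Gen] [MeasurableSpace Gen] [BorelSpace Gen]
    [MetricSpace Pol] [CompactSpace Pol] [Nonempty Pol] [MeasurableSpace Pol] [BorelSpace Pol]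
    (law : Gen → ProbabilityMeasure Goal) (R : Goal → Pol → ℝ)
    (hint : ∀ (GA GB : Gen) (πA πB : Pol),
      Integrable (fun g : Goal × Goal => CuSP.sampleObjective R g.1 g.2 πA πB)
        ((law GA : Measure Goal).prod (law GB : Measure Goal)))
    (hF : Continuous fun x : Gen × Gen × Pol × Pol =>
      CuSP.payoff law R x.1 x.2.1 x.2.2.1 x.2.2.2) :
    ∃ σ τ : ProbabilityMeasure (Gen × Pol), (CuSP.game law R).IsMixedNash σ τ := by
  obtain ⟨σ, hσ⟩ := (CuSP.game law R).exists_isMixedNash_of_antisymm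
    (hF.comp (by fun_prop : Continuous fun p : (Gen × Pol) × (Gen × Pol) =>
      (p.1.1, p.2.1, p.1.2, p.2.2)))
    (fun _ => rfl) (fun p => CuSP.payoff_swap law R p.1.1 p.2.1 p.1.2 p.2.2)
  exact ⟨σ, σ, hσ⟩
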